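/- All graphs are finite and simple. For an integer $k\ge 2$, a graph is called $k$-connected if it has more than $k$ vertices and remains connected after the removal of any set of fewer than $k$ vertices. A dominating path of a graph $G$ is a path $P$ in $G$ (a single vertex counts as a path) such that every vertex of $G$ is at distance at most one from the vertex set $V(P)$. Let $k\ge 2$ be an integer and let $G$ be a $k$-connected graph on $n$ vertices with $k>\frac{n-4}{5}$. Then $G$ has a dominating path. -/

import Mathlib

namespace PathEcc

/-- A finite graph is `k`-connected if it has more than `k` vertices and it stays connected
after the deletion of any set of fewer than `k` vertices. -/
def IsKConnected {V : Type*} [Fintype V] (G : SimpleGraph V) (k : ℕ) : Prop :=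
  k < Fintype.card V ∧
    ∀ S : Finset V, S.card < k → (G.induce {v : V | v ∉ S}).Connected

/-- The distance `d_G(u, S)` from a vertex `u` to a set `S` of vertices: the minimum of
`d_G(u, v)` over `v ∈ S` (infinite if no vertex of `S` can be reached from `u`). -/
noncomputable def distToSet {V : Type*} (G : SimpleGraph V) (u : V) (S : Set V) : ℕ∞ :=
  ⨅ v ∈ S, G.edist u v

/-- The eccentricity `ecc_G(P) = max {d_G(u, V(P)) : u ∈ V(G)}` of a walk `P`. -/
noncomputable def ecc {V : Type*} (G : SimpleGraph V) {a b : V} (P : G.Walk a b) : ℕ∞ :=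
  ⨆ u : V, distToSet G u {v : V | v ∈ P.support}

/-- An `l`-dominating path: a path (no repeated vertices, possibly of length zero) of
eccentricity at most `l`. -/
def IsDominatingPath {V : Type*} (G : SimpleGraph V) (l : ℕ) {a b : V} (P : G.Walk a b) : Prop :=
  P.IsPath ∧ ecc G P ≤ (l : ℕ∞)

/-- `G` has a dominating path: a path such that every vertex of `G` is at distance at most one
from it. -/
def HasDominatingPath {V : Type*} (G : SimpleGraph V) : Prop :=
  ∃ (a b : V) (P : G.Walk a b), IsDominatingPath G 1 P

end PathEcc

/-! Suppose there is no dominating path. Among all paths take `P = f 0, …, f L` dominating as many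
vertices as possible and, subject to that, of maximal length, and let `u` be undominated by `P`. Any
path through `u` that dominated everything `P` dominates would beat `P`; this is `Optimal`, and
every later contradiction exhibits such a path.

Maximal length together with minimum degree at least `k` gives `P` at least `k` vertices, so
Menger's theorem yields a fan of `k` paths from `u` to `P`. Its ends cut `P` into `k + 1` segments.
Detouring through `u` around segment `i` must lose a vertex, so some vertex is dominated by `P` only
from segment `i`, and not by the fan path `Q i`. Choose `w i` to be such a vertex whose last
dominating position on `P` is as early as possible. Then `P` can be rerouted so as to skip the part
of the segment before `w i` at no cost.

Consequently any short connection between `u` and `w i` (`not_bypass`), or between `w i` and `w j`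
(`not_crossing`), would give a forbidden path through `u`. Hence the closed neighbourhoods of `u, w
0, …, w k` are pairwise disjoint, and they miss the `k` fan ends. Counting gives at least `(k + 2)
(k + 1) + k` vertices, which is at least `5 k + 4` when `k ≥ 2`. -/

namespace PathEcc

/-! ### Paths with a given vertex set, and walks avoiding a set. -/

variable {V : Type*}

/-- There is a path of `G` from `u` to `v` whose vertex set is exactly `W`. -/
def PathOn (G : SimpleGraph V) (u v : V) (W : Set V) : Prop :=
  ∃ p : G.Walk u v, p.IsPath ∧ ∀ z, z ∈ W ↔ z ∈ p.support

/-- There is a walk of `G` from `u` to `v` that avoids `S`. -/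
def ReachAvoiding (G : SimpleGraph V) (S : Set V) (u v : V) : Prop :=
  ∃ p : G.Walk u v, ∀ z ∈ p.support, z ∉ S

namespace PathOn

variable {G H : SimpleGraph V} {u v w z : V} {W W' : Set V}

theorem refl (G : SimpleGraph V) (u : V) : PathOn G u u {u} :=
  ⟨.nil, by simp, by simp⟩

theorem of_adj (h : G.Adj u v) : PathOn G u v {u, v} :=
  ⟨h.toWalk, by simp [SimpleGraph.Walk.isPath_def, h.ne], by simp⟩

theorem symm (h : PathOn G u v W) : PathOn G v u W := by
  obtain ⟨p, hp, hW⟩ := h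
  exact ⟨p.reverse, hp.reverse, by simpa using hW⟩

theorem left_mem (h : PathOn G u v W) : u ∈ W := by
  obtain ⟨p, hp, hW⟩ := h
  simp [hW]

theorem right_mem (h : PathOn G u v W) : v ∈ W := by
  obtain ⟨p, hp, hW⟩ := h
  simp [hW]

theorem mono (hGH : G ≤ H) (h : PathOn G u v W) : PathOn H u v W := by
  obtain ⟨p, hp, hW⟩ := h
  exact ⟨p.mapLe hGH, by simpa using hp, by simpa using hW⟩

theorem join (h : PathOn G u v W) (h' : PathOn G v w W')
    (hd : ∀ z ∈ W, z ∈ W' → z = v) : PathOn G u w (W ∪ W') := by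
  obtain ⟨p, hp, hW⟩ := h
  obtain ⟨q, hq, hW'⟩ := h'
  refine ⟨p.append q, ?_, fun z => by simp [hW, hW']⟩
  rw [SimpleGraph.Walk.isPath_def, SimpleGraph.Walk.support_append, List.nodup_append]
  have hqs := hq.support_nodup
  rw [← SimpleGraph.Walk.cons_tail_support, List.nodup_cons] at hqs
  refine ⟨hp.support_nodup, hqs.2, ?_⟩
  rintro a ha _ hb rfl
  have := hd a ((hW a).2 ha) ((hW' a).2 (List.mem_of_mem_tail hb))
  exact hqs.1 (this ▸ hb)

theorem split (h : PathOn G u v W) (hz : z ∈ W) :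
    ∃ W₁ W₂, PathOn G u z W₁ ∧ PathOn G z v W₂ ∧ W₁ ⊆ W ∧ W₂ ⊆ W ∧ (v ∈ W₁ → v = z) ∧
      (u ∈ W₂ → u = z) := by
  classical
  obtain ⟨p, hp, hW⟩ := h
  have hz' := (hW z).1 hz
  obtain ⟨q, r, hq, hr, rfl⟩ := hp.mem_support_iff_exists_append.1 hz'
  refine ⟨{x | x ∈ q.support}, {x | x ∈ r.support}, ⟨q, hq, fun _ => Iff.rfl⟩,
    ⟨r, hr, fun _ => Iff.rfl⟩, fun x hx => (hW x).2 ?_, fun x hx => (hW x).2 ?_, ?_, ?_⟩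
  · exact SimpleGraph.Walk.mem_support_append_iff _ _ |>.2 (Or.inl hx)
  · exact SimpleGraph.Walk.mem_support_append_iff _ _ |>.2 (Or.inr hx)
  · intro hv
    by_contra hne
    exact hp.ne_of_mem_support_of_append hne hv r.end_mem_support rfl
  · intro hu
    by_contra hne
    exact hp.ne_of_mem_support_of_append hne q.start_mem_support hu rfl

theorem exists_first_hit (h : PathOn G u v W) {B : Set V} (hv : v ∈ B) :
    ∃ b ∈ B, ∃ W' ⊆ W, PathOn G u b W' ∧ ∀ z ∈ W', z ∈ B → z = b := by
  obtain ⟨p, hp, hW⟩ := h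
  induction p generalizing W with
  | nil => exact ⟨_, hv, {_}, by simp [hW], refl G _, by simp⟩
  | @cons x y t hxy p ih =>
    by_cases hx : x ∈ B
    · exact ⟨x, hx, {x}, by simp [hW], refl G _, by simp⟩
    · rw [SimpleGraph.Walk.cons_isPath_iff] at hp
      obtain ⟨b, hb, W', hW', hP, hf⟩ := ih hv hp.1 (W := {z | z ∈ p.support}) (fun _ => Iff.rfl)
      refine ⟨b, hb, {x, y} ∪ W', ?_, (of_adj hxy).join hP ?_, ?_⟩
      · rintro z ((rfl | rfl) | hz)
        · simp [hW]
        · simp [hW]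
        · rw [hW, SimpleGraph.Walk.support_cons]
          exact List.mem_cons_of_mem _ (hW' hz)
      · rintro z (rfl | rfl) hz
        · exact absurd (hW' hz) hp.2
        · rfl
      · rintro z ((rfl | rfl) | hz) hzB
        · exact absurd hzB hx
        · exact hf _ hP.left_mem hzB
        · exact hf z hz hzB

theorem reachAvoiding {S : Set V} (h : PathOn G u v W) (hS : ∀ z ∈ W, z ∉ S) :
    ReachAvoiding G S u v := by
  obtain ⟨p, hp, hW⟩ := h
  exact ⟨p, fun z hz => hS z ((hW z).2 hz)⟩

end PathOn

namespace ReachAvoiding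

variable {G H : SimpleGraph V} {S : Set V} {u v w x y : V}

theorem refl (hu : u ∉ S) : ReachAvoiding G S u u := ⟨.nil, by simpa using hu⟩

theorem symm (h : ReachAvoiding G S u v) : ReachAvoiding G S v u := by
  obtain ⟨p, hp⟩ := h
  exact ⟨p.reverse, by simpa using hp⟩

theorem trans (h : ReachAvoiding G S u v) (h' : ReachAvoiding G S v w) :
    ReachAvoiding G S u w := by
  obtain ⟨p, hp⟩ := h
  obtain ⟨q, hq⟩ := h'
  refine ⟨p.append q, fun z hz => ?_⟩
  rw [SimpleGraph.Walk.mem_support_append_iff] at hz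
  exact hz.elim (hp z) (hq z)

theorem of_adj (h : G.Adj u v) (hu : u ∉ S) (hv : v ∉ S) : ReachAvoiding G S u v :=
  (PathOn.of_adj h).reachAvoiding (by rintro z (rfl | rfl) <;> assumption)

theorem exists_pathOn (h : ReachAvoiding G S u v) :
    ∃ W, PathOn G u v W ∧ ∀ z ∈ W, z ∉ S := by
  classical
  obtain ⟨p, hp⟩ := h
  exact ⟨{z | z ∈ p.bypass.support}, ⟨p.bypass, p.bypass_isPath, fun _ => Iff.rfl⟩,
    fun z hz => hp z (p.support_bypass_subset_support hz)⟩

/-- A walk avoiding `Z` but not `S` has an initial part that avoids `Z` and ends in `S`. -/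
theorem exists_mem_of_not {Z : Set V} (h : ReachAvoiding G Z u v) (hS : ¬ ReachAvoiding G S u v) :
    ∃ s ∈ S, ReachAvoiding G Z u s ∧ ReachAvoiding G Z s v := by
  obtain ⟨W, hW, hZ⟩ := h.exists_pathOn
  by_contra hcon
  refine hS (hW.reachAvoiding fun z hz hzS => hcon ⟨z, hzS, ?_⟩)
  obtain ⟨W₁, W₂, h₁, h₂, hs₁, hs₂, -⟩ := hW.split hz
  exact ⟨h₁.reachAvoiding fun t ht => hZ t (hs₁ ht), h₂.reachAvoiding fun t ht => hZ t (hs₂ ht)⟩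

/-- Cut the walk at its first and last traversal of the edge `x y`. If these run in opposite
directions, the two outer pieces share an end and already join `u` to `v` in `H`. -/
theorem of_almost_le (hGH : ∀ a b, G.Adj a b → H.Adj a b ∨ (a = x ∧ b = y) ∨ (a = y ∧ b = x))
    (h : ReachAvoiding G S u v) :
    ReachAvoiding H S u v ∨ (ReachAvoiding H S u x ∧ ReachAvoiding H S y v) ∨
      (ReachAvoiding H S u y ∧ ReachAvoiding H S x v) := by
  obtain ⟨p, hp⟩ := h
  induction p with
  | nil => exact Or.inl (refl (by simpa using hp))
  | @cons a b c hab p ih =>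
    have ha : a ∉ S := hp a (by simp)
    have hb : b ∉ S := hp b (by simp)
    have ih := ih fun z hz => hp z (by simp [hz])
    rcases hGH a b hab with h1 | ⟨rfl, rfl⟩ | ⟨rfl, rfl⟩
    · have h2 : ReachAvoiding H S a b := of_adj h1 ha hb
      rcases ih with h | h | h
      · exact Or.inl (h2.trans h)
      · exact Or.inr (Or.inl ⟨h2.trans h.1, h.2⟩)
      · exact Or.inr (Or.inr ⟨h2.trans h.1, h.2⟩)
    · rcases ih with h | h | h
      · exact Or.inr (Or.inl ⟨refl ha, h⟩)
      · exact Or.inr (Or.inl ⟨refl ha, h.2⟩)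
      · exact Or.inl h.2
    · rcases ih with h | h | h
      · exact Or.inr (Or.inr ⟨refl ha, h⟩)
      · exact Or.inl h.2
      · exact Or.inr (Or.inr ⟨refl ha, h.2⟩)

end ReachAvoiding

/-! ### Menger's theorem, by induction on the edges. -/

/-- `S` separates `A` from `B` in `G`. -/
def Separates (G : SimpleGraph V) (S A B : Set V) : Prop :=
  ∀ a ∈ A, ∀ b ∈ B, ¬ ReachAvoiding G S a b

/-- There are `k` pairwise disjoint paths from `A` to `B`. -/
def Linked (G : SimpleGraph V) (k : ℕ) (A B : Set V) : Prop :=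
  ∃ (a b : Fin k → V) (W : Fin k → Set V),
    (∀ i, a i ∈ A ∧ b i ∈ B ∧ PathOn G (a i) (b i) (W i)) ∧ ∀ i j z, z ∈ W i → z ∈ W j → i = j

/-- `k` disjoint paths ending in a set of size `k` can be indexed by that set. -/
theorem Linked.exists_indexed {G : SimpleGraph V} {k : ℕ} {A : Set V} {X : Finset V}
    (h : Linked G k A X) (hX : X.card = k) :
    ∃ (a : V → V) (W : V → Set V), (∀ x ∈ X, a x ∈ A ∧ PathOn G (a x) x (W x) ∧
      ∀ z ∈ W x, z ∈ X → z = x) ∧ ∀ x ∈ X, ∀ y ∈ X, ∀ z, z ∈ W x → z ∈ W y → x = y := by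
  classical
  obtain ⟨a, b, W, h, hd⟩ := h
  have hinj : Function.Injective b := fun i j hij =>
    hd i j (b i) (h i).2.2.right_mem (hij ▸ (h j).2.2.right_mem)
  have himg : Finset.univ.image b = X := by
    refine Finset.eq_of_subset_of_card_le ?_ ?_
    · intro x hx
      obtain ⟨i, -, rfl⟩ := Finset.mem_image.1 hx
      exact (h i).2.1
    · rw [Finset.card_image_of_injective _ hinj]
      simp [hX]
  have hsurj : ∀ x ∈ X, ∃ i, b i = x := by
    intro x hx
    rw [← himg] at hx
    simpa using hx
  have hk : ∀ x, ∃ i : Option (Fin k), x ∈ X → ∃ j, i = some j ∧ b j = x := by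
    intro x
    by_cases hx : x ∈ X
    · obtain ⟨i, hi⟩ := hsurj x hx
      exact ⟨some i, fun _ => ⟨i, rfl, hi⟩⟩
    · exact ⟨none, fun h => absurd h hx⟩
  choose g hg using hk
  refine ⟨fun x => (g x).elim x a, fun x => (g x).elim ∅ W, ?_, ?_⟩
  · intro x hx
    obtain ⟨j, hj, rfl⟩ := hg x hx
    simp only [hj, Option.elim_some]
    refine ⟨(h j).1, (h j).2.2, fun z hz hzX => ?_⟩
    obtain ⟨i, rfl⟩ := hsurj z hzX
    rw [hd i j _ (h i).2.2.right_mem hz]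
  · intro x hx y hy z
    obtain ⟨j, hj, rfl⟩ := hg x hx
    obtain ⟨i, hi, rfl⟩ := hg y hy
    simp only [hj, hi, Option.elim_some]
    intro h1 h2
    rw [hd j i z h1 h2]

/-- The inductive step of Menger's theorem: `x y` is the deleted edge, and `S` a small separator
of the graph without it. -/
theorem linked_of_small_separator {G H : SimpleGraph V} {k : ℕ} {A B : Set V} {x y : V}
    (hHG : H ≤ G) (hxy : G.Adj x y)
    (hGH : ∀ a b, G.Adj a b → H.Adj a b ∨ (a = x ∧ b = y) ∨ (a = y ∧ b = x))
    (ih : ∀ A B : Set V, (∀ S : Finset V, Separates H S A B → k ≤ S.card) → Linked H k A B)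
    (hG : ∀ S : Finset V, Separates G S A B → k ≤ S.card)
    {S : Finset V} (hS : Separates H S A B) (hSk : S.card < k)
    {a b : V} (ha : a ∈ A) (hb : b ∈ B) (hax : ReachAvoiding H S a x)
    (hyb : ReachAvoiding H S y b) : Linked G k A B := by
  classical
  -- In `H` without `S`, the vertex `x` lies on the `A` side and `y` on the `B` side. So a set
  -- separating `A` from `S ∪ {x}`, or `B` from `S ∪ {y}`, in `H` separates `A` from `B` in `G`, and
  -- the induction hypothesis applies to both pairs.
  have hAy : ∀ a' ∈ A, ¬ ReachAvoiding H S a' y := fun a' ha' hr => hS a' ha' b hb (hr.trans hyb)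
  have hxB : ∀ b' ∈ B, ¬ ReachAvoiding H S x b' := fun b' hb' hr => hS a ha b' hb' (hax.trans hr)
  have hAX : ∀ Z : Finset V, Separates H Z A (insert x S : Finset V) → k ≤ Z.card := by
    refine fun Z hZ => hG Z fun a' ha' b' hb' hr => ?_
    have key : ∀ v, ReachAvoiding H Z a' v → ¬ ReachAvoiding H S a' v → False := by
      intro v hv hv'
      obtain ⟨s, hs, hs', -⟩ := hv.exists_mem_of_not hv'
      exact hZ a' ha' s (by simpa using Or.inr hs) hs'
    rcases hr.of_almost_le hGH with h | h | h
    · exact key _ h (hS a' ha' b' hb')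
    · exact hZ a' ha' x (by simp) h.1
    · exact key _ h.1 (hAy a' ha')
  have hYB : ∀ Z : Finset V, Separates H Z B (insert y S : Finset V) → k ≤ Z.card := by
    refine fun Z hZ => hG Z fun a' ha' b' hb' hr => ?_
    have key : ∀ v, ReachAvoiding H Z v b' → ¬ ReachAvoiding H S v b' → False := by
      intro v hv hv'
      obtain ⟨s, hs, -, hs'⟩ := hv.exists_mem_of_not hv'
      exact hZ b' hb' s (by simpa using Or.inr hs) hs'.symm
    rcases hr.of_almost_le hGH with h | h | h
    · exact key _ h (hS a' ha' b' hb')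
    · exact hZ b' hb' y (by simp) h.2.symm
    · exact key _ h.2 (hxB b' hb')
  have hXk : k ≤ (insert x S).card := hAX _ fun a' _ x' hx' hr => by
    obtain ⟨p, hp⟩ := hr
    exact hp x' (by simp) hx'
  have hYk : k ≤ (insert y S).card := hYB _ fun a' _ x' hx' hr => by
    obtain ⟨p, hp⟩ := hr
    exact hp x' (by simp) hx'
  have hX : (insert x S).card = k := le_antisymm ((Finset.card_insert_le _ _).trans hSk) hXk
  have hY : (insert y S).card = k := le_antisymm ((Finset.card_insert_le _ _).trans hSk) hYk
  have hxS : x ∉ S := fun h => by rw [Finset.insert_eq_of_mem h] at hX; omega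
  have hyS : y ∉ S := fun h => by rw [Finset.insert_eq_of_mem h] at hY; omega
  obtain ⟨a', W, hW, hWd⟩ := (ih _ _ hAX).exists_indexed hX
  obtain ⟨b', U, hU, hUd⟩ := (ih _ _ hYB).exists_indexed hY
  -- The two linkages meet only in `S`: at a common vertex outside `S`, the initial pieces would
  -- form an `A`–`B` walk of `H` avoiding `S`.
  have hcross : ∀ s ∈ insert x S, ∀ t ∈ insert y S, ∀ z, z ∈ W s → z ∈ U t → z = s ∧ z = t := by
    intro s hs t ht z hzs hzt
    obtain ⟨W₁, -, h₁, -, hs₁, -, hv₁, -⟩ := (hW s hs).2.1.split hzs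
    obtain ⟨U₁, -, h₂, -, hs₂, -, hv₂, -⟩ := (hU t ht).2.1.split hzt
    have hz : z ∈ S := by
      by_contra hz
      have e₁ : ∀ r ∈ W₁, r ∉ S := fun r hr hrS => hz <| by
        have := (hW s hs).2.2 r (hs₁ hr) (by simp [hrS])
        rw [this] at hr
        rw [← hv₁ hr, ← this]
        exact hrS
      have e₂ : ∀ r ∈ U₁, r ∉ S := fun r hr hrS => hz <| by
        have := (hU t ht).2.2 r (hs₂ hr) (by simp [hrS])
        rw [this] at hr
        rw [← hv₂ hr, ← this]
        exact hrS
      exact hS _ (hW s hs).1 _ (hU t ht).1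
        ((h₁.reachAvoiding e₁).trans (h₂.reachAvoiding e₂).symm)
    exact ⟨(hW s hs).2.2 z hzs (by simp [hz]), (hU t ht).2.2 z hzt (by simp [hz])⟩
  -- The linkages are glued at the vertices of `S`, and along the edge `x y` for the remaining pair.
  set g : V → V := fun s => if s = x then y else s with hg
  have hgx : g x = y := by simp [hg]
  have hgS : ∀ s ∈ S, g s = s := fun s hs => by
    have : s ≠ x := fun h => hxS (h ▸ hs)
    simp [hg, this]
  have hgY : ∀ s ∈ insert x S, g s ∈ insert y S := by
    intro s hs
    rcases Finset.mem_insert.1 hs with rfl | hs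
    · simp [hgx]
    · simp [hgS s hs, hs]
  have hginj : ∀ s ∈ insert x S, ∀ t ∈ insert x S, g s = g t → s = t := by
    intro s hs t ht h
    rcases Finset.mem_insert.1 hs with rfl | hs' <;>
      rcases Finset.mem_insert.1 ht with rfl | ht'
    · rfl
    · rw [hgx, hgS t ht'] at h
      exact absurd (h ▸ ht') hyS
    · rw [hgx, hgS s hs'] at h
      exact absurd (h ▸ hs') hyS
    · rwa [hgS s hs', hgS t ht'] at h
  have hcross' : ∀ s ∈ insert x S, ∀ t ∈ insert x S, ∀ z, z ∈ W s → z ∈ U (g t) →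
      z = s ∧ s = t ∧ s ∈ S := by
    intro s hs t ht z h1 h2
    obtain ⟨rfl, e⟩ := hcross s hs _ (hgY t ht) z h1 h2
    rcases Finset.mem_insert.1 ht with rfl | ht
    · rw [hgx] at e
      exact absurd e (by rintro rfl; exact hxy.ne (by simpa [hyS, eq_comm] using hs))
    · rw [hgS t ht] at e
      exact ⟨rfl, e, e ▸ ht⟩
  have hpath : ∀ s ∈ insert x S, PathOn G (a' s) (b' (g s)) (W s ∪ U (g s)) := by
    intro s hs
    have h1 := (hW s hs).2.1.mono hHG
    have h2 := ((hU _ (hgY s hs)).2.1.mono hHG).symm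
    rcases Finset.mem_insert.1 hs with rfl | hs'
    · rw [hgx] at h2 ⊢
      have h3 := (h1.join (PathOn.of_adj hxy) ?_).join h2 ?_
      · convert h3 using 1
        ext z
        simp only [Set.mem_union, Set.mem_insert_iff, Set.mem_singleton_iff]
        constructor
        · tauto
        · rintro ((h | rfl | rfl) | h)
          · exact Or.inl h
          · exact Or.inl h1.right_mem
          · exact Or.inr h2.left_mem
          · exact Or.inr h
      · rintro z hz (rfl | rfl)
        · rfl
        · exact absurd (hcross' s hs s hs z hz (hgx ▸ h2.left_mem)).2.2 hxS
      · rintro z (hz | rfl | rfl) hz'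
        · exact absurd (hcross' s hs s hs z hz (hgx ▸ hz')).2.2 hxS
        · exact absurd (hcross' z hs z hs z h1.right_mem (hgx ▸ hz')).2.2 hxS
        · rfl
    · rw [hgS s hs'] at h2 ⊢
      refine h1.join h2 fun z hz hz' => (hcross' s hs s hs z hz ?_).1
      rwa [hgS s hs']
  let e := (Finset.equivFinOfCardEq hX).symm
  refine ⟨fun i => a' (e i), fun i => b' (g (e i)), fun i => W (e i) ∪ U (g (e i)),
    fun i => ⟨(hW _ (e i).2).1, (hU _ (hgY _ (e i).2)).1, hpath _ (e i).2⟩, ?_⟩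
  intro i j z hi hj
  refine e.injective (Subtype.ext ?_)
  rcases hi with hi | hi <;> rcases hj with hj | hj
  · exact hWd _ (e i).2 _ (e j).2 z hi hj
  · exact (hcross' _ (e i).2 _ (e j).2 z hi hj).2.1
  · exact (hcross' _ (e j).2 _ (e i).2 z hj hi).2.1.symm
  · exact hginj _ (e i).2 _ (e j).2 (hUd _ (hgY _ (e i).2) _ (hgY _ (e j).2) z hi hj)

/-- **Menger's theorem** for two sets of vertices of a finite graph. -/
theorem linked_of_le_card_separators [Finite V] (G : SimpleGraph V) (k : ℕ) (A B : Set V)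
    (h : ∀ S : Finset V, Separates G S A B → k ≤ S.card) : Linked G k A B := by
  classical
  have := Fintype.ofFinite V
  induction G using WellFoundedLT.induction generalizing A B with
  | ind G ih =>
  by_cases hbot : ∃ x y, G.Adj x y
  · obtain ⟨x, y, hxy⟩ := hbot
    set H := G.deleteEdges {s(x, y)} with hH
    have hle : H ≤ G := SimpleGraph.deleteEdges_le _
    have hlt : H < G := by
      refine lt_of_le_of_ne hle fun he => ?_
      have : H.Adj x y := he ▸ hxy
      simp [hH] at this
    have hGH : ∀ a b, G.Adj a b → H.Adj a b ∨ (a = x ∧ b = y) ∨ (a = y ∧ b = x) := by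
      intro a b hab
      by_cases hs : s(a, b) = s(x, y)
      · exact Or.inr (by simpa using hs)
      · exact Or.inl (by rw [hH, SimpleGraph.deleteEdges_adj]; exact ⟨hab, hs⟩)
    by_cases hsep : ∀ S : Finset V, Separates H S A B → k ≤ S.card
    · obtain ⟨a, b, W, h1, h2⟩ := ih H hlt A B hsep
      exact ⟨a, b, W, fun i => ⟨(h1 i).1, (h1 i).2.1, (h1 i).2.2.mono hle⟩, h2⟩
    · push Not at hsep
      obtain ⟨S, hS, hSk⟩ := hsep
      have hnot : ¬ Separates G S A B := fun hs => absurd (h S hs) (by omega)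
      unfold Separates at hnot
      push Not at hnot
      obtain ⟨a, ha, b, hb, hr⟩ := hnot
      rcases hr.of_almost_le hGH with h' | h' | h'
      · exact absurd h' (hS a ha b hb)
      · exact linked_of_small_separator hle hxy hGH (ih H hlt) h hS hSk ha hb h'.1 h'.2
      · exact linked_of_small_separator hle hxy.symm (fun a b hab => (hGH a b hab).imp_right Or.symm)
          (ih H hlt) h hS hSk ha hb h'.1 h'.2
  · push Not at hbot
    -- Without edges every walk is trivial, so `A ∩ B` separates and its vertices serve as the
    -- paths.
    have hk : k ≤ (A ∩ B).toFinset.card := by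
      refine h _ fun a ha b hb hr => ?_
      obtain ⟨p, hp⟩ := hr
      cases p with
      | nil => exact hp a (by simp) (by simp [ha, hb])
      | cons hadj _ => exact hbot _ _ hadj
    obtain ⟨T, hT, hTk⟩ := Finset.exists_subset_card_eq hk
    let e := (Finset.equivFinOfCardEq hTk).symm
    refine ⟨fun i => e i, fun i => e i, fun i => {(e i : V)}, fun i => ?_, fun i j z hi hj => ?_⟩
    · have := hT (e i).2
      rw [Set.mem_toFinset] at this
      exact ⟨this.1, this.2, PathOn.refl _ _⟩
    · exact e.injective (Subtype.ext (hi.symm.trans hj))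

/-! ### Consequences of `k`-connectivity and the fan lemma. -/

variable {G : SimpleGraph V}

theorem ReachAvoiding.anti {S T : Set V} {u v : V} (hST : S ⊆ T) (h : ReachAvoiding G T u v) :
    ReachAvoiding G S u v := by
  obtain ⟨p, hp⟩ := h
  exact ⟨p, fun z hz hzS => hp z hz (hST hzS)⟩

theorem ReachAvoiding.of_adj_imp {H : SimpleGraph V} {S : Set V} {u v : V}
    (hGH : ∀ a b, a ∉ S → b ∉ S → G.Adj a b → H.Adj a b) (h : ReachAvoiding G S u v) :
    ReachAvoiding H S u v := by
  obtain ⟨p, hp⟩ := h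
  induction p with
  | nil => exact .refl (hp _ (by simp))
  | @cons a b c hab p ih =>
    have ha : a ∉ S := hp a (by simp)
    have hb : b ∉ S := hp b (by simp)
    exact (ReachAvoiding.of_adj (hGH a b ha hb hab) ha hb).trans
      (ih fun z hz => hp z (by simp [hz]))

theorem PathOn.ne_of_isolated {a b u : V} {W : Set V} (h : PathOn G a b W) (ha : a ≠ u)
    (hu : ∀ v, ¬ G.Adj v u) : ∀ z ∈ W, z ≠ u := by
  obtain ⟨p, -, hW⟩ := h
  suffices ∀ z ∈ p.support, z ≠ u from fun z hz => this z ((hW z).1 hz)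
  clear hW
  induction p with
  | nil => simpa using ha
  | @cons x y c hxy p ih =>
    intro z hz
    rw [SimpleGraph.Walk.support_cons, List.mem_cons] at hz
    rcases hz with rfl | hz
    · exact ha
    · exact ih (by rintro rfl; exact hu _ hxy) z hz

theorem IsKConnected.reachAvoiding [Fintype V] {k : ℕ} (hG : IsKConnected G k) {S : Finset V}
    (hS : S.card < k) {u v : V} (hu : u ∉ S) (hv : v ∉ S) : ReachAvoiding G S u v := by
  obtain ⟨p⟩ := (hG.2 S hS).preconnected ⟨u, hu⟩ ⟨v, hv⟩
  let φ : G.induce {v : V | v ∉ S} →g G := ⟨Subtype.val, fun h => h⟩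
  refine ⟨p.map φ, fun z hz => ?_⟩
  rw [SimpleGraph.Walk.support_map, List.mem_map] at hz
  obtain ⟨⟨y, hy⟩, -, rfl⟩ := hz
  exact hy

theorem IsKConnected.le_card_adj [Fintype V] {k : ℕ} (hG : IsKConnected G k) (u : V)
    {N : Finset V} (hN : ∀ v, v ∈ N ↔ G.Adj u v) : k ≤ N.card := by
  classical
  by_contra! hlt
  have huN : u ∉ N := by simp [hN]
  obtain ⟨v, hv⟩ : ∃ v, v ∉ insert u N := by
    by_contra! hall
    have h1 : (insert u N) = Finset.univ := Finset.eq_univ_iff_forall.2 hall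
    have h2 := Finset.card_insert_le u N
    rw [h1, Finset.card_univ] at h2
    have := hG.1
    omega
  rw [Finset.mem_insert, not_or] at hv
  obtain ⟨p, hp⟩ := hG.reachAvoiding hlt huN hv.2
  cases p with
  | nil => exact hv.1 rfl
  | @cons _ b _ hab p => exact hp b (by simp) ((hN b).2 hab)

/-- The fan lemma. -/
theorem IsKConnected.exists_fan [Fintype V] {k : ℕ} (hG : IsKConnected G k) {P : Finset V} {u : V}
    (hu : u ∉ P) (hP : k ≤ P.card) :
    ∃ (x : Fin k → V) (W : Fin k → Set V), (∀ i, x i ∈ P ∧ PathOn G u (x i) (W i) ∧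
      ∀ z ∈ W i, z ∈ P → z = x i) ∧ ∀ i j z, z ∈ W i → z ∈ W j → i = j ∨ z = u := by
  classical
  -- Deleting all edges at `u` keeps the linkage from the neighbours of `u` to `P` away from `u`, so
  -- that `u` can be prepended to each path.
  let H : SimpleGraph V :=
    { Adj := fun a b => G.Adj a b ∧ a ≠ u ∧ b ≠ u
      symm := ⟨fun a b h => ⟨h.1.symm, h.2.2, h.2.1⟩⟩
      loopless := ⟨fun a h => G.loopless.irrefl a h.1⟩ }
  have hHG : H ≤ G := fun a b h => h.1
  have hlink : Linked H k {v | G.Adj u v} P := by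
    refine linked_of_le_card_separators H k _ _ fun S hS => ?_
    by_contra! hlt
    obtain ⟨b, hbP, hbS⟩ : ∃ b ∈ P, b ∉ S := by
      by_contra! hall
      exact absurd (Finset.card_le_card hall) (by omega)
    -- The separator may contain `u`, which is useless in `H`. It is erased so that connectivity of
    -- `G` can be applied from `u` itself.
    have hlt' : (S.erase u).card < k := (Finset.card_erase_le).trans_lt hlt
    have hr := hG.reachAvoiding hlt' (by simp) (fun h => hbS (Finset.mem_of_mem_erase h))
      (u := u) (v := b)
    obtain ⟨W, ⟨p, hp, hW⟩, hWS⟩ := hr.exists_pathOn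
    cases p with
    | nil => exact hu hbP
    | @cons _ a _ hua p =>
      rw [SimpleGraph.Walk.cons_isPath_iff] at hp
      have h1 : ReachAvoiding G (insert u S : Set V) a b := by
        refine ⟨p, fun z hz hzS => ?_⟩
        have h2 := hWS z ((hW z).2 (by simp [hz]))
        rcases hzS with rfl | hzS
        · exact hp.2 hz
        · exact h2 (by
            simp only [Finset.coe_erase]
            exact ⟨hzS, fun h => hp.2 (h ▸ hz)⟩)
      have h2 : ReachAvoiding H (insert u S : Set V) a b := h1.of_adj_imp fun c d hc hd hcd =>
        ⟨hcd, fun h => hc (Or.inl h), fun h => hd (Or.inl h)⟩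
      exact hS a hua b hbP (h2.anti (Set.subset_insert _ _))
  obtain ⟨a, b, W, hW, hd⟩ := hlink
  have hmain : ∀ i, ∃ x ∈ P, ∃ W' ⊆ W i, PathOn G u x (insert u W') ∧
      ∀ z ∈ insert u W', z ∈ P → z = x := by
    intro i
    obtain ⟨ha, hb, hp⟩ := hW i
    have hne := hp.ne_of_isolated (u := u) (fun h => G.loopless.irrefl u (h ▸ ha : G.Adj u u))
      fun v hv => hv.2.2 rfl
    obtain ⟨x, hx, W', hW', hp', hf⟩ := hp.exists_first_hit (B := (P : Set V)) hb
    refine ⟨x, hx, W', hW', ?_, ?_⟩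
    · have := (PathOn.of_adj (G := G) ha).join (hp'.mono hHG) ?_
      · convert this using 1
        ext z
        simp only [Set.mem_union, Set.mem_insert_iff, Set.mem_singleton_iff]
        constructor
        · tauto
        · rintro ((h | rfl) | h)
          · exact Or.inl h
          · exact Or.inr hp'.left_mem
          · exact Or.inr h
      · rintro z (rfl | rfl) hz
        · exact absurd rfl (hne z (hW' hz))
        · rfl
    · rintro z (rfl | hz) hzP
      · exact absurd hzP hu
      · exact hf z hz hzP
  choose x hx W' hW' hp hf using hmain
  refine ⟨x, fun i => insert u (W' i), fun i => ⟨hx i, hp i, hf i⟩, ?_⟩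
  rintro i j z (rfl | hi) hj
  · exact Or.inr rfl
  · rcases hj with rfl | hj
    · exact Or.inr rfl
    · exact Or.inl (hd i j z (hW' i hi) (hW' j hj))

/-! ### Fan systems on an optimal path, and rerouting through `u`. -/

/-- Distance at most one. -/
def Near (G : SimpleGraph V) (z v : V) : Prop := z = v ∨ G.Adj z v

theorem Near.symm {z v : V} (h : Near G z v) : Near G v z := h.imp Eq.symm fun h => h.symm

theorem Near.reachAvoiding {S : Set V} {z v : V} (h : Near G z v) (hz : z ∉ S) (hv : v ∉ S) :
    ReachAvoiding G S z v := by
  rcases h with rfl | h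
  · exact .refl hz
  · exact .of_adj h hz hv

/-- A path `f 0, …, f L` together with paths `Q i` from a vertex `u` far from it to the vertices
`f (c i - 1)`, disjoint except for `u`; the index `0` stands for the trivial path at `u`. -/
structure FanSystem (G : SimpleGraph V) (k : ℕ) (f : ℕ → V) (L : ℕ) (u : V) where
  adj : ∀ s < L, G.Adj (f s) (f (s + 1))
  inj : ∀ s ≤ L, ∀ t ≤ L, f s = f t → s = t
  far : ∀ s ≤ L, ¬ Near G (f s) u
  c : Fin (k + 1) → ℕ
  Q : Fin (k + 1) → Set V
  strictMono : StrictMono c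
  c_zero : c 0 = 0
  c_le : ∀ i, c i ≤ L + 1
  Q_zero : Q 0 = {u}
  path : ∀ i, i ≠ 0 → PathOn G u (f (c i - 1)) (insert (f (c i - 1)) (Q i))
  mem : ∀ i, u ∈ Q i
  off : ∀ i, ∀ s ≤ L, f s ∉ Q i
  inter : ∀ i j z, i ≠ j → z ∈ Q i → z ∈ Q j → z = u

theorem pathOn_segment {f : ℕ → V} {L : ℕ} (adj : ∀ s < L, G.Adj (f s) (f (s + 1)))
    (inj : ∀ s ≤ L, ∀ t ≤ L, f s = f t → s = t) {s t : ℕ} (hst : s ≤ t) (ht : t ≤ L) :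
    PathOn G (f s) (f t) {z | ∃ r, s ≤ r ∧ r ≤ t ∧ z = f r} := by
  induction t, hst using Nat.le_induction with
  | base =>
    convert PathOn.refl G (f s) using 1
    ext z
    constructor
    · rintro ⟨r, h1, h2, rfl⟩
      rw [le_antisymm h2 h1]
      rfl
    · rintro rfl
      exact ⟨s, le_rfl, le_rfl, rfl⟩
  | succ t hst ih =>
    have h := (ih (by omega)).join (PathOn.of_adj (adj t ht)) ?_
    · convert h using 1
      ext z
      constructor
      · rintro ⟨r, h1, h2, rfl⟩
        rcases Nat.lt_or_ge t r with h3 | h3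
        · exact Or.inr (Or.inr (by rw [show r = t + 1 by omega]; rfl))
        · exact Or.inl ⟨r, h1, h3, rfl⟩
      · rintro (⟨r, h1, h2, rfl⟩ | rfl | rfl)
        · exact ⟨r, h1, by omega, rfl⟩
        · exact ⟨t, hst, by omega, rfl⟩
        · exact ⟨t + 1, by omega, le_rfl, rfl⟩
    · rintro z ⟨r, h1, h2, rfl⟩ (h3 | h3)
      · exact h3
      · have := inj r (by omega) (t + 1) ht h3
        omega

namespace FanSystem

variable {k L : ℕ} {f : ℕ → V} {u : V} (F : FanSystem G k f L u)

/-- The positions strictly between the attachment vertices number `i` and `i + 1`. -/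
def InSeg (i : Fin (k + 1)) (s : ℕ) : Prop := F.c i ≤ s ∧ s ≤ L ∧ ∀ j, i < j → s + 1 < F.c j

/-- The vertices dominated by `f` only in segment `i`, and not dominated by `Q i`. -/
def Exclusive (i : Fin (k + 1)) (v : V) : Prop :=
  (∃ s ≤ L, Near G (f s) v) ∧ (∀ s ≤ L, Near G (f s) v → F.InSeg i s) ∧ ∀ z ∈ F.Q i, ¬ Near G z v

/-- Vertices dominated only before position `q` of segment `i` are dominated by `Q i`. -/
def Skippable (i : Fin (k + 1)) (q : ℕ) : Prop :=
  ∀ v, (∀ s ≤ L, Near G (f s) v → F.c i ≤ s ∧ s < q) → (∃ s ≤ L, Near G (f s) v) →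
    ∃ z ∈ F.Q i, Near G z v

/-- No path through `u` dominates everything that `f` dominates. -/
def Optimal (G : SimpleGraph V) (f : ℕ → V) (L : ℕ) (u : V) : Prop :=
  ∀ a b W, PathOn G a b W → u ∈ W → ∃ s ≤ L, ∃ v, Near G (f s) v ∧ ∀ z ∈ W, ¬ Near G z v

theorem inSeg_of_lt {i : Fin (k + 1)} {q s : ℕ} (hq : F.InSeg i q) (h : F.c i ≤ s) (hs : s < q) :
    F.InSeg i s :=
  ⟨h, hs.le.trans hq.2.1, fun j hj => by have := hq.2.2 j hj; omega⟩

theorem Skippable.mono {i : Fin (k + 1)} {q r : ℕ} (h : F.Skippable i q) (hr : r ≤ q) :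
    F.Skippable i r := fun v h1 h2 =>
  h v (fun s hs hn => ⟨(h1 s hs hn).1, (h1 s hs hn).2.trans_le hr⟩) h2

theorem inSeg_unique {i j : Fin (k + 1)} {s : ℕ} (hi : F.InSeg i s) (hj : F.InSeg j s) :
    i = j := by
  rcases lt_trichotomy i j with h | h | h
  · have := hi.2.2 j h
    have := hj.1
    omega
  · exact h
  · have := hj.2.2 i h
    have := hi.1
    omega

theorem c_pos {i : Fin (k + 1)} (hi : i ≠ 0) : 0 < F.c i := by
  have := F.strictMono (Fin.pos_of_ne_zero hi)
  omega

/-- This is the common beginning of all reroutings: follow `f` up to attachment vertex number `i`,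
then `Q i` back to `u`. For `i = 0` it is the single vertex `u`. -/
theorem exists_initial (i : Fin (k + 1)) :
    ∃ a, PathOn G a u ({z | ∃ r < F.c i, z = f r} ∪ F.Q i) := by
  by_cases hi : i = 0
  · subst hi
    refine ⟨u, ?_⟩
    convert PathOn.refl G u using 1
    ext z
    simp [F.c_zero, F.Q_zero]
  · have hpos := F.c_pos hi
    have hle := F.c_le i
    have h := (pathOn_segment F.adj F.inj (Nat.zero_le (F.c i - 1)) (by omega)).join
      (F.path i hi).symm ?_
    · refine ⟨f 0, ?_⟩
      convert h using 1
      ext z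
      constructor
      · rintro (⟨r, hr, rfl⟩ | h)
        · exact Or.inl ⟨r, by omega, by omega, rfl⟩
        · exact Or.inr (Or.inr h)
      · rintro (⟨r, -, hr, rfl⟩ | rfl | h)
        · exact Or.inl ⟨r, by omega, rfl⟩
        · exact Or.inl ⟨F.c i - 1, by omega, rfl⟩
        · exact Or.inr h
    · rintro z ⟨r, -, hr, rfl⟩ (h | h)
      · exact h
      · exact absurd h (F.off i r (by omega))

/-- The path that leaves `f` at attachment vertex `i`, visits `u` and returns at attachment vertex
`i + 1` omits only segment `i` of `f`, so by optimality it loses a vertex. The first segment is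
replaced by a start at `u`, the last by an end at `u`. -/
theorem exists_exclusive (hopt : Optimal G f L u) (i : Fin (k + 1)) : ∃ v, F.Exclusive i v := by
  obtain ⟨a, hA⟩ := F.exists_initial i
  obtain ⟨b, W, hW, hAW, hj⟩ : ∃ b W, PathOn G a b W ∧
      {z | ∃ r < F.c i, z = f r} ∪ F.Q i ⊆ W ∧
      ∀ j, i < j → ∀ r ≤ L, F.c j ≤ r + 1 → f r ∈ W := by
    by_cases hl : ∃ j, i < j
    · obtain ⟨j, hij, hmin⟩ : ∃ j, i < j ∧ ∀ j', i < j' → F.c j ≤ F.c j' := by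
        obtain ⟨j, hij⟩ := hl
        have hi : i.val + 1 < k + 1 := by
          have := j.2
          have : i.val < j.val := hij
          omega
        refine ⟨⟨i.val + 1, hi⟩, by simp [Fin.lt_def], fun j' hj' => F.strictMono.monotone ?_⟩
        have : i.val < j'.val := hj'
        simp only [Fin.le_def]
        omega
      have hj0 : j ≠ 0 := Fin.ne_zero_of_lt hij
      have hpos := F.c_pos hj0
      have hle := F.c_le j
      have hlt := F.strictMono hij
      have h := (hA.join (F.path j hj0) ?_).join
        (pathOn_segment F.adj F.inj (show F.c j - 1 ≤ L by omega) le_rfl) ?_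
      · refine ⟨_, _, h, fun z hz => Or.inl (Or.inl hz), fun j' hj' r hr hcr => Or.inr ?_⟩
        have := hmin j' hj'
        exact ⟨r, by omega, hr, rfl⟩
      · rintro z (⟨r, hr, rfl⟩ | hz) (hz' | hz')
        · have := F.inj r (by omega) _ (by omega) hz'
          omega
        · exact absurd hz' (F.off j r (by omega))
        · exact absurd (hz' ▸ hz) (F.off i _ (by omega))
        · exact F.inter i j z hij.ne hz hz'
      · rintro z ((⟨r, hr, rfl⟩ | hz) | hz | hz) ⟨s, hs, hsL, e⟩
        · have := F.inj r (by omega) _ (by omega) e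
          omega
        · exact absurd (e ▸ hz) (F.off i _ (by omega))
        · exact hz
        · exact absurd (e ▸ hz) (F.off j _ (by omega))
    · exact ⟨u, _, hA, subset_rfl, fun j hj => absurd ⟨j, hj⟩ hl⟩
  obtain ⟨s, hs, v, hsv, hv⟩ := hopt _ _ _ hW (hAW (Or.inr (F.mem i)))
  refine ⟨v, ⟨s, hs, hsv⟩, fun t ht htv => ⟨?_, ht, fun j hij => ?_⟩,
    fun z hz => hv z (hAW (Or.inr hz))⟩
  · by_contra! hlt
    exact hv _ (hAW (Or.inl ⟨t, hlt, rfl⟩)) htv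
  · by_contra! hle
    exact hv _ (hj j hij t ht hle) htv

/-- An exclusive vertex `w` of segment `i` with a suitable vertex `f q` dominating it. -/
theorem exists_anchor (hopt : Optimal G f L u) (i : Fin (k + 1)) :
    ∃ w q, F.Exclusive i w ∧ F.InSeg i q ∧ Near G (f q) w ∧
      (∀ s ≤ L, w = f s → s = q) ∧ F.Skippable i q := by
  classical
  -- Minimising the last dominating position makes `q` skippable: a vertex violating this would be
  -- exclusive with all its dominating positions before `q`.
  have hex : ∃ p, ∃ v, F.Exclusive i v ∧ ∀ s ≤ L, Near G (f s) v → s ≤ p := by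
    obtain ⟨v, hv⟩ := F.exists_exclusive hopt i
    exact ⟨L, v, hv, fun s hs _ => hs⟩
  obtain ⟨w, hw, hp⟩ := Nat.find_spec hex
  -- If `w` lies on `f`, then `q` must be its own position, so that `w` stays outside the forbidden
  -- sets in the rerouting lemmas.
  obtain ⟨q, hqp, hq, hqw, hwq⟩ : ∃ q ≤ Nat.find hex, F.InSeg i q ∧ Near G (f q) w ∧
      (∀ s ≤ L, w = f s → s = q) := by
    by_cases hwf : ∃ s ≤ L, w = f s
    · obtain ⟨s, hs, rfl⟩ := hwf
      exact ⟨s, hp s hs (Or.inl rfl), hw.2.1 s hs (Or.inl rfl), Or.inl rfl,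
        fun t ht h => F.inj t ht s hs h.symm⟩
    · obtain ⟨s, hs, hsw⟩ := hw.1
      exact ⟨s, hp s hs hsw, hw.2.1 s hs hsw, hsw, fun t ht h => absurd ⟨t, ht, h⟩ hwf⟩
  refine ⟨w, q, hw, hq, hqw, hwq, fun v hv hv' => ?_⟩
  by_contra! hcon
  have hexc : F.Exclusive i v :=
    ⟨hv', fun s hs hsv => F.inSeg_of_lt hq (hv s hs hsv).1 (hv s hs hsv).2, hcon⟩
  obtain ⟨s, hs, hsv⟩ := hv'
  have hsq := (hv s hs hsv).2
  refine Nat.find_min hex (m := q - 1) (by omega) ⟨v, hexc, fun t ht htv => ?_⟩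
  have := (hv t ht htv).2
  omega

/-- The part of segment `i` before a skippable position `q` cannot be bypassed by a path from `u`
to `f q`. -/
theorem not_bypass (hopt : Optimal G f L u) {i : Fin (k + 1)} {q : ℕ} (hq : F.InSeg i q)
    (hskip : F.Skippable i q) :
    ¬ ReachAvoiding G {z | (z ∈ F.Q i ∧ z ≠ u) ∨ ∃ s ≤ L, z = f s ∧ s ≠ q} u (f q) := by
  intro hr
  obtain ⟨T, hT, hTS⟩ := hr.exists_pathOn
  obtain ⟨a, hA⟩ := F.exists_initial i
  have hTf : ∀ s ≤ L, f s ∈ T → s = q := fun s hs h => by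
    by_contra hne
    exact hTS _ h (Or.inr ⟨s, hs, rfl, hne⟩)
  have hTQ : ∀ z ∈ T, z ∈ F.Q i → z = u := fun z hz h => by
    by_contra hne
    exact hTS _ hz (Or.inl ⟨h, hne⟩)
  -- Reroute as `f 0`, …, attachment vertex `i`, `Q i`, `u`, `T`, `f q`, …, `f L`; only the
  -- positions from `c i` to `q - 1` are lost.
  have hci := hq.1
  have hqL := hq.2.1
  have h := (hA.join hT ?_).join (pathOn_segment F.adj F.inj hqL le_rfl) ?_
  · obtain ⟨s, hs, v, hsv, hv⟩ := hopt _ _ _ h (Or.inl (Or.inl (Or.inr (F.mem i))))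
    have hlost : ∀ t ≤ L, Near G (f t) v → F.c i ≤ t ∧ t < q := by
      intro t ht htv
      by_contra! hcon
      rcases Nat.lt_or_ge t (F.c i) with h1 | h1
      · exact hv _ (Or.inl (Or.inl (Or.inl ⟨t, h1, rfl⟩))) htv
      · exact hv _ (Or.inr ⟨t, hcon h1, ht, rfl⟩) htv
    obtain ⟨z, hz, hzv⟩ := hskip v hlost ⟨s, hs, hsv⟩
    exact hv z (Or.inl (Or.inl (Or.inr hz))) hzv
  · rintro z (⟨r, hr, rfl⟩ | hz) hz'
    · have := hTf r (by omega) hz'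
      omega
    · exact hTQ z hz' hz
  · rintro z ((⟨r, hr, rfl⟩ | hz) | hz) ⟨s, hs, hsL, e⟩
    · have := F.inj r (by omega) s hsL e
      omega
    · exact absurd (e ▸ hz) (F.off i s hsL)
    · rw [e, hTf s hsL (e ▸ hz)]

/-- Two segments are not joined by a path outside `f` and the fan between skippable positions. -/
theorem not_crossing (hopt : Optimal G f L u) {i j : Fin (k + 1)} (hij : i < j) (n : ℕ) :
    ∀ q t, q + t = n → F.InSeg i q → F.InSeg j t → F.Skippable i q → F.Skippable j t →
    ¬ ReachAvoiding G {z | z ∈ F.Q i ∨ z ∈ F.Q j ∨ ∃ s ≤ L, z = f s ∧ s ≠ q ∧ s ≠ t}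
      (f q) (f t) := by
  induction n using Nat.strong_induction_on with
  | _ n ih =>
  rintro q t rfl hq ht hiq hjt hr
  obtain ⟨T, hT, hTS⟩ := hr.exists_pathOn
  obtain ⟨a, hA⟩ := F.exists_initial i
  have hTf : ∀ s ≤ L, f s ∈ T → s = q ∨ s = t := fun s hs h => by
    by_contra! hne
    exact hTS _ h (Or.inr (Or.inr ⟨s, hs, rfl, hne⟩))
  have hTi : ∀ z ∈ T, z ∉ F.Q i := fun z hz h => hTS _ hz (Or.inl h)
  have hTj : ∀ z ∈ T, z ∉ F.Q j := fun z hz h => hTS _ hz (Or.inr (Or.inl h))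
  have hj0 : j ≠ 0 := Fin.ne_zero_of_lt hij
  have hpos := F.c_pos hj0
  have hle := F.c_le j
  have hlt := F.strictMono hij
  have hci := hq.1
  have hqL := hq.2.1
  have hqj := hq.2.2 j hij
  have hcj := ht.1
  have htL := ht.2.1
  -- From `u` the new path takes `Q j` to attachment vertex `j`, runs backwards along `f` to `f q`,
  -- crosses by `T` to `f t` and continues to the end. It omits only the parts of segments `i` and
  -- `j` before `q` and `t`.
  have h := (((hA.join (F.path j hj0) ?_).join
    (pathOn_segment F.adj F.inj (show q ≤ F.c j - 1 by omega) (by omega)).symm ?_).join hT ?_).join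
    (pathOn_segment F.adj F.inj htL le_rfl) ?_
  · set R := (((({z | ∃ r < F.c i, z = f r} ∪ F.Q i) ∪ insert (f (F.c j - 1)) (F.Q j)) ∪
      {z | ∃ r, q ≤ r ∧ r ≤ F.c j - 1 ∧ z = f r}) ∪ T) ∪ {z | ∃ r, t ≤ r ∧ r ≤ L ∧ z = f r}
    have hRi : F.Q i ⊆ R := fun z hz => Or.inl (Or.inl (Or.inl (Or.inl (Or.inr hz))))
    have hRj : F.Q j ⊆ R := fun z hz => Or.inl (Or.inl (Or.inl (Or.inr (Or.inr hz))))
    obtain ⟨s, hs, v, hsv, hv⟩ := hopt _ _ _ h (hRi (F.mem i))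
    have hpos : ∀ r ≤ L, Near G (f r) v → (F.c i ≤ r ∧ r < q) ∨ (F.c j ≤ r ∧ r < t) := by
      intro r hr hrv
      have h1 : ¬ r < F.c i := fun h =>
        hv _ (Or.inl (Or.inl (Or.inl (Or.inl (Or.inl ⟨r, h, rfl⟩))))) hrv
      have h2 : ¬ (q ≤ r ∧ r ≤ F.c j - 1) := fun h =>
        hv _ (Or.inl (Or.inl (Or.inr ⟨r, h.1, h.2, rfl⟩))) hrv
      have h3 : ¬ t ≤ r := fun h => hv _ (Or.inr ⟨r, h, hr, rfl⟩) hrv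
      omega
    have hnot : ∀ q' t', F.c i ≤ q' → q' < q → F.c j ≤ t' → t' < t →
        ¬ ReachAvoiding G {z | z ∈ F.Q i ∨ z ∈ F.Q j ∨ ∃ s ≤ L, z = f s ∧ s ≠ q' ∧ s ≠ t'}
          (f q') (f t') := fun q' t' h1 h2 h3 h4 =>
      ih (q' + t') (by omega) q' t' rfl (F.inSeg_of_lt hq h1 h2) (F.inSeg_of_lt ht h3 h4)
        (Skippable.mono F hiq h2.le) (Skippable.mono F hjt h4.le)
    have hoff : ∀ r ≤ L, ∀ q' t', (r = q' ∨ r = t') →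
        f r ∉ {z | z ∈ F.Q i ∨ z ∈ F.Q j ∨ ∃ s ≤ L, z = f s ∧ s ≠ q' ∧ s ≠ t'} := by
      rintro r hr q' t' hrr (h | h | ⟨s, hs, e, h1, h2⟩)
      · exact F.off i r hr h
      · exact F.off j r hr h
      · have := F.inj r hr s hs e
        omega
    -- A lost vertex dominated from both omitted parts is itself a crossing between positions `q' <
    -- q` and `t' < t`, excluded by induction on `q + t`. Dominated from one part only, it is
    -- covered by `Q i` or `Q j` through skippability.
    have hone : (∀ r ≤ L, Near G (f r) v → F.c i ≤ r ∧ r < q) ∨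
        (∀ r ≤ L, Near G (f r) v → F.c j ≤ r ∧ r < t) := by
      by_contra! hcon
      obtain ⟨⟨t', ht'L, ht'v, ht'⟩, ⟨q', hq'L, hq'v, hq'⟩⟩ := hcon
      have ht'' : F.c j ≤ t' ∧ t' < t := (hpos t' ht'L ht'v).resolve_left (fun h => by
        have := ht' h.1
        omega)
      have hq'' : F.c i ≤ q' ∧ q' < q := (hpos q' hq'L hq'v).resolve_right (fun h => by
        have := hq' h.1
        omega)
      by_cases hvf : ∃ r ≤ L, v = f r
      · obtain ⟨r, hrL, rfl⟩ := hvf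
        rcases hpos r hrL (Or.inl rfl) with h1 | h1
        · exact hnot r t' h1.1 h1.2 ht''.1 ht''.2
            (ht'v.symm.reachAvoiding (hoff r hrL _ _ (by simp)) (hoff t' ht'L _ _ (by simp)))
        · exact hnot q' r hq''.1 hq''.2 h1.1 h1.2
            (hq'v.reachAvoiding (hoff q' hq'L _ _ (by simp)) (hoff r hrL _ _ (by simp)))
      · have hvS : v ∉ {z | z ∈ F.Q i ∨ z ∈ F.Q j ∨ ∃ s ≤ L, z = f s ∧ s ≠ q' ∧ s ≠ t'} := by
          rintro (h | h | ⟨s, hs, e, -⟩)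
          · exact hv v (hRi h) (Or.inl rfl)
          · exact hv v (hRj h) (Or.inl rfl)
          · exact hvf ⟨s, hs, e⟩
        exact hnot q' t' hq''.1 hq''.2 ht''.1 ht''.2
          ((hq'v.reachAvoiding (hoff q' hq'L _ _ (by simp)) hvS).trans
            (ht'v.symm.reachAvoiding hvS (hoff t' ht'L _ _ (by simp))))
    rcases hone with h1 | h1
    · obtain ⟨z, hz, hzv⟩ := hiq v h1 ⟨s, hs, hsv⟩
      exact hv z (hRi hz) hzv
    · obtain ⟨z, hz, hzv⟩ := hjt v h1 ⟨s, hs, hsv⟩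
      exact hv z (hRj hz) hzv
  · rintro z (⟨r, hr, rfl⟩ | hz) (hz' | hz')
    · have := F.inj r (by omega) _ (by omega) hz'
      omega
    · exact absurd hz' (F.off j r (by omega))
    · exact absurd (hz' ▸ hz) (F.off i _ (by omega))
    · exact F.inter i j z hij.ne hz hz'
  · rintro z ((⟨r, hr, rfl⟩ | hz) | hz | hz) ⟨s, hs, hsL, e⟩
    · have := F.inj r (by omega) _ (by omega) e
      omega
    · exact absurd (e ▸ hz) (F.off i _ (by omega))
    · exact hz
    · exact absurd (e ▸ hz) (F.off j _ (by omega))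
  · rintro z (((⟨r, hr, rfl⟩ | hz) | rfl | hz) | ⟨s, hs, hsL, rfl⟩) hz'
    · have := hTf r (by omega) hz'
      omega
    · exact absurd hz (hTi z hz')
    · have := hTf _ (by omega) hz'
      rw [show F.c j - 1 = q by omega]
    · exact absurd hz (hTj z hz')
    · have := hTf _ (by omega) hz'
      rw [show s = q by omega]
  · rintro z ((((⟨r, hr, rfl⟩ | hz) | rfl | hz) | ⟨s, hs, hsL, rfl⟩) | hz) ⟨s', hs', hsL', e⟩
    · have := F.inj _ (by omega) _ (by omega) e
      omega
    · exact absurd (e ▸ hz) (F.off i _ (by omega))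
    · have := F.inj _ (by omega) _ (by omega) e
      omega
    · exact absurd (e ▸ hz) (F.off j _ (by omega))
    · have := F.inj _ (by omega) _ (by omega) e
      omega
    · have := hTf s' hsL' (e ▸ hz)
      rw [e, show s' = t by omega]

/-- The closed neighbourhoods of `u` and of suitable vertices `w i` are pairwise disjoint, and they
miss the attachment vertices. -/
theorem exists_disjoint_near (hopt : Optimal G f L u) :
    ∃ w : Fin (k + 1) → V, (∀ i y, Near G u y → ¬ Near G (w i) y) ∧
      (∀ i j y, i ≠ j → Near G (w i) y → ¬ Near G (w j) y) ∧
      (∀ i j, j ≠ 0 → ¬ Near G (w i) (f (F.c j - 1))) := by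
  choose w q hw hq hqw hwq hskip using F.exists_anchor hopt
  -- If `w i` were on another fan path `Q j`, following `Q j` from `u` to `w i` and stepping to `f
  -- (q i)` would be a forbidden bypass.
  have hwQ : ∀ i j, w i ∉ F.Q j := by
    intro i j hmem
    by_cases hji : j = i
    · subst hji
      exact (hw j).2.2 _ hmem (Or.inl rfl)
    have hwu : w i ≠ u := fun h => (hw i).2.2 u (F.mem i) (Or.inl h.symm)
    have hj0 : j ≠ 0 := by
      rintro rfl
      rw [F.Q_zero] at hmem
      exact hwu hmem
    have hcj := F.c_le j
    have hpos := F.c_pos hj0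
    obtain ⟨W, -, hW, -, hWQ, -, hx, -⟩ := (F.path j hj0).split (Set.mem_insert_of_mem _ hmem)
    refine F.not_bypass hopt (hq i) (hskip i) ((hW.reachAvoiding ?_).trans
      ((hqw i).symm.reachAvoiding ?_ ?_))
    · rintro z hz (⟨hzi, hzu⟩ | ⟨s, hs, rfl, hsq⟩)
      · rcases hWQ hz with rfl | hzj
        · exact F.off i _ (by omega) hzi
        · exact hzu (F.inter i j z (Ne.symm hji) hzi hzj)
      · rcases hWQ hz with h | h
        · exact F.off j _ (by omega) (hx (h ▸ hz) ▸ hmem)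
        · exact F.off j s hs h
    · rintro (⟨hzi, -⟩ | ⟨s, hs, e, hsq⟩)
      · exact (hw i).2.2 _ hzi (Or.inl rfl)
      · exact hsq (hwq i s hs e)
    · rintro (⟨hzi, -⟩ | ⟨s, hs, e, hsq⟩)
      · exact F.off i _ (hq i).2.1 hzi
      · exact hsq (F.inj _ (hq i).2.1 _ hs e).symm
  have hlt : ∀ i j y, i < j → Near G (w i) y → ¬ Near G (w j) y := by
    intro i j y hij hi hj
    have hoff : ∀ r ≤ L, (r = q i ∨ r = q j) →
        f r ∉ {z | z ∈ F.Q i ∨ z ∈ F.Q j ∨ ∃ s ≤ L, z = f s ∧ s ≠ q i ∧ s ≠ q j} := by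
      rintro r hr hrr (h | h | ⟨s, hs, e, h1, h2⟩)
      · exact F.off i r hr h
      · exact F.off j r hr h
      · have := F.inj r hr s hs e
        omega
    have hy : y ∉ {z | z ∈ F.Q i ∨ z ∈ F.Q j ∨ ∃ s ≤ L, z = f s ∧ s ≠ q i ∧ s ≠ q j} := by
      rintro (h | h | ⟨s, hs, rfl, h1, h2⟩)
      · exact (hw i).2.2 y h hi.symm
      · exact (hw j).2.2 y h hj.symm
      · exact hij.ne (F.inSeg_unique ((hw i).2.1 s hs hi.symm) ((hw j).2.1 s hs hj.symm))
    have hwi : w i ∉ {z | z ∈ F.Q i ∨ z ∈ F.Q j ∨ ∃ s ≤ L, z = f s ∧ s ≠ q i ∧ s ≠ q j} := by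
      rintro (h | h | ⟨s, hs, e, h1, h2⟩)
      · exact hwQ _ _ h
      · exact hwQ _ _ h
      · exact h1 (hwq i s hs e)
    have hwj : w j ∉ {z | z ∈ F.Q i ∨ z ∈ F.Q j ∨ ∃ s ≤ L, z = f s ∧ s ≠ q i ∧ s ≠ q j} := by
      rintro (h | h | ⟨s, hs, e, h1, h2⟩)
      · exact hwQ _ _ h
      · exact hwQ _ _ h
      · exact h2 (hwq j s hs e)
    refine F.not_crossing hopt hij _ (q i) (q j) rfl (hq i) (hq j) (hskip i) (hskip j) ?_
    exact ((((hqw i).reachAvoiding (hoff _ (hq i).2.1 (by simp)) hwi).trans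
      (hi.reachAvoiding hwi hy)).trans (hj.symm.reachAvoiding hy hwj)).trans
      ((hqw j).symm.reachAvoiding hwj (hoff _ (hq j).2.1 (by simp)))
  refine ⟨w, fun i y hu hi => ?_, fun i j y hij => ?_, fun i j hj0 hn => ?_⟩
  · have hu' : u ∉ {z | (z ∈ F.Q i ∧ z ≠ u) ∨ ∃ s ≤ L, z = f s ∧ s ≠ q i} := by
      rintro (h | ⟨s, hs, e, -⟩)
      · exact h.2 rfl
      · exact F.off i s hs (e ▸ F.mem i)
    have hy : y ∉ {z | (z ∈ F.Q i ∧ z ≠ u) ∨ ∃ s ≤ L, z = f s ∧ s ≠ q i} := by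
      rintro (h | ⟨s, hs, rfl, -⟩)
      · exact (hw i).2.2 y h.1 hi.symm
      · exact F.far s hs hu.symm
    have hwi : w i ∉ {z | (z ∈ F.Q i ∧ z ≠ u) ∨ ∃ s ≤ L, z = f s ∧ s ≠ q i} := by
      rintro (h | ⟨s, hs, e, h1⟩)
      · exact hwQ _ _ h.1
      · exact h1 (hwq i s hs e)
    refine F.not_bypass hopt (hq i) (hskip i) (((hu.reachAvoiding hu' hy).trans
      (hi.symm.reachAvoiding hy hwi)).trans ((hqw i).symm.reachAvoiding hwi ?_))
    rintro (⟨hzi, -⟩ | ⟨s, hs, e, hsq⟩)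
    · exact F.off i _ (hq i).2.1 hzi
    · exact hsq (F.inj _ (hq i).2.1 _ hs e).symm
  · rcases lt_or_gt_of_ne hij with h | h
    · exact hlt i j y h
    · exact fun h1 h2 => hlt j i y h h2 h1
  · have hcj := F.c_le j
    have hpos := F.c_pos hj0
    -- An attachment vertex lies in no segment, so it cannot dominate an exclusive vertex.
    obtain ⟨h1, -, h3⟩ := (hw i).2.1 _ (by omega) hn.symm
    rcases lt_or_ge i j with h | h
    · have := h3 j h
      omega
    · have := F.strictMono.monotone h
      omega

end FanSystem

/-! ### Counting, construction of the fan system and the extremal path. -/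

/-- The closed neighbourhoods of `u` and of the `k + 1` vertices `w i` have at least `k + 1`
vertices each; they are disjoint from one another and from the `k` attachment vertices. -/
theorem FanSystem.card_le [Fintype V] {k L : ℕ} {f : ℕ → V} {u : V} (F : FanSystem G k f L u)
    (hopt : FanSystem.Optimal G f L u) (hG : IsKConnected G k) :
    (k + 2) * (k + 1) + k ≤ Fintype.card V := by
  classical
  obtain ⟨w, h1, h2, h3⟩ := F.exists_disjoint_near hopt
  let N : V → Finset V := fun v => Finset.univ.filter (Near G v)
  have hN : ∀ v, k + 1 ≤ (N v).card := by
    intro v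
    have h := hG.le_card_adj v (N := Finset.univ.filter (G.Adj v)) (by simp)
    have hins : insert v (Finset.univ.filter (G.Adj v)) = N v := by
      ext y
      simp [N, Near, eq_comm]
    rw [← hins, Finset.card_insert_of_notMem (by simp)]
    omega
  let X : Finset V := (Finset.univ.erase (0 : Fin (k + 1))).image fun j => f (F.c j - 1)
  have hX : X.card = k := by
    rw [Finset.card_image_of_injOn, Finset.card_erase_of_mem (Finset.mem_univ _)]
    · simp
    · intro i hi j hj e
      have hi' := F.c_pos (Finset.ne_of_mem_erase hi)
      have hj' := F.c_pos (Finset.ne_of_mem_erase hj)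
      have hi'' := F.c_le i
      have hj'' := F.c_le j
      have := F.inj _ (by omega) _ (by omega) e
      exact F.strictMono.injective (by omega)
  let B : Finset V := Finset.univ.biUnion fun i => N (w i)
  have hB : (k + 1) * (k + 1) ≤ B.card := by
    rw [Finset.card_biUnion]
    · simpa using Finset.card_nsmul_le_sum Finset.univ (fun i => (N (w i)).card) (k + 1)
        fun i _ => hN (w i)
    · intro i _ j _ hij
      refine Finset.disjoint_left.2 fun y hy => ?_
      simp only [N, Finset.mem_filter, Finset.mem_univ, true_and] at hy ⊢
      exact h2 i j y hij hy
  have hd1 : Disjoint (N u) B := by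
    rw [Finset.disjoint_left]
    intro y hy
    simp only [B, N, Finset.mem_filter, Finset.mem_univ, true_and, Finset.mem_biUnion,
      not_exists] at hy ⊢
    exact fun i => h1 i y hy
  have hd2 : Disjoint (N u ∪ B) X := by
    rw [Finset.disjoint_right]
    intro y hy
    obtain ⟨j, hj, rfl⟩ := Finset.mem_image.1 hy
    have hj0 := Finset.ne_of_mem_erase hj
    have hpos := F.c_pos hj0
    have hle := F.c_le j
    simp only [B, N, Finset.mem_filter, Finset.mem_univ, true_and, Finset.mem_biUnion,
      not_exists, Finset.mem_union, not_or]
    exact ⟨fun h => F.far _ (by omega) h.symm, fun i => h3 i j hj0⟩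
  have hcard : ((N u ∪ B) ∪ X).card ≤ Fintype.card V := Finset.card_le_univ _
  rw [Finset.card_union_of_disjoint hd2, Finset.card_union_of_disjoint hd1, hX] at hcard
  have := hN u
  nlinarith

/-- A sequence of vertices far from `u` that carries a fan from `u` yields a fan system. -/
theorem exists_fanSystem [Fintype V] {k L : ℕ} {f : ℕ → V} {u : V} (hG : IsKConnected G k)
    (adj : ∀ s < L, G.Adj (f s) (f (s + 1))) (inj : ∀ s ≤ L, ∀ t ≤ L, f s = f t → s = t)
    (far : ∀ s ≤ L, ¬ Near G (f s) u) (hkL : k ≤ L + 1) : Nonempty (FanSystem G k f L u) := by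
  classical
  let P : Finset V := (Finset.range (L + 1)).image f
  have hP : k ≤ P.card := by
    rw [Finset.card_image_of_injOn]
    · simpa using hkL
    · intro s hs t ht e
      simp only [Finset.coe_range, Set.mem_Iio] at hs ht
      exact inj s (by omega) t (by omega) e
  have hmemP : ∀ s ≤ L, f s ∈ P := fun s hs =>
    Finset.mem_image_of_mem _ (Finset.mem_range.2 (by omega))
  have hu : u ∉ P := by
    intro h
    obtain ⟨s, hs, e⟩ := Finset.mem_image.1 h
    exact far s (by have := Finset.mem_range.1 hs; omega) (Or.inl e)
  obtain ⟨x, W, hW, hd⟩ := hG.exists_fan hu hP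
  have hpos : ∀ i, ∃ s ≤ L, f s = x i := by
    intro i
    obtain ⟨s, hs, e⟩ := Finset.mem_image.1 (hW i).1
    exact ⟨s, by have := Finset.mem_range.1 hs; omega, e⟩
  choose e heL hex using hpos
  have hxu : ∀ i, x i ≠ u := fun i h => hu (h ▸ (hW i).1)
  have heinj : Function.Injective e := by
    intro i j hij
    have hx : x i = x j := by rw [← hex, ← hex, hij]
    exact (hd i j (x i) (hW i).2.1.right_mem (hx ▸ (hW j).2.1.right_mem)).resolve_right (hxu i)
  have hE : (Finset.univ.image e).card = k := by
    rw [Finset.card_image_of_injective _ heinj]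
    simp
  -- The fan paths are renumbered in the order of their ends along `f`. The shift by one in `c`
  -- leaves index `0` for the trivial path at `u`.
  let o := (Finset.univ.image e).orderEmbOfFin hE
  have ho : ∀ m, ∃ i, e i = o m := by
    intro m
    obtain ⟨i, -, hi⟩ := Finset.mem_image.1 (Finset.orderEmbOfFin_mem (Finset.univ.image e) hE m)
    exact ⟨i, hi⟩
  choose σ hσ using ho
  have hσinj : Function.Injective σ := fun m m' h => o.injective (by rw [← hσ, ← hσ, h])
  refine ⟨{
    adj := adj
    inj := inj
    far := far
    c := Fin.cons 0 fun m => o m + 1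
    Q := Fin.cons {u} fun m => W (σ m) \ {x (σ m)}
    strictMono := ?_
    c_zero := rfl
    c_le := ?_
    Q_zero := rfl
    path := ?_
    mem := ?_
    off := ?_
    inter := ?_ }⟩
  · intro i j hij
    cases j using Fin.cases with
    | zero => exact absurd hij (Fin.not_lt_zero _)
    | succ j =>
      cases i using Fin.cases with
      | zero => simp
      | succ i => simpa using hij
  · intro i
    cases i using Fin.cases with
    | zero => simp
    | succ i =>
      have := heL (σ i)
      rw [hσ] at this
      simpa using this
  · intro i hi
    cases i using Fin.cases with
    | zero => exact absurd rfl hi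
    | succ i =>
      have h := (hW (σ i)).2.1
      simp only [Fin.cons_succ, Nat.add_sub_cancel]
      rw [← hσ, hex, Set.insert_sdiff_singleton, Set.insert_eq_of_mem h.right_mem]
      exact h
  · intro i
    cases i using Fin.cases with
    | zero => simp
    | succ i => exact ⟨(hW (σ i)).2.1.left_mem, fun h => hxu _ (Eq.symm h)⟩
  · intro i s hs h
    cases i using Fin.cases with
    | zero => exact far s hs (Or.inl h)
    | succ i => exact h.2 ((hW (σ i)).2.2 _ h.1 (hmemP s hs))
  · intro i j z hij hi hj
    cases i using Fin.cases with
    | zero => exact hi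
    | succ i =>
      cases j using Fin.cases with
      | zero => exact hj
      | succ j =>
        refine (hd _ _ z hi.1 hj.1).resolve_left fun h => hij ?_
        exact congrArg Fin.succ (hσinj h)

theorem hasDominatingPath_of_forall_near {a b : V} {p : G.Walk a b} (hp : p.IsPath)
    (h : ∀ v, ∃ z ∈ p.support, Near G z v) : HasDominatingPath G := by
  refine ⟨a, b, p, hp, iSup_le fun v => ?_⟩
  obtain ⟨z, hz, hzv⟩ := h v
  refine (iInf₂_le z hz).trans ?_
  rw [Nat.cast_one, SimpleGraph.edist_le_one_iff_adj_or_eq]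
  exact hzv.elim (fun h => Or.inr h.symm) fun h => Or.inl h.symm

/-- A path that dominates as much as possible and is then as long as possible. -/
theorem exists_optimal_path [Fintype V] [Nonempty V] (G : SimpleGraph V) :
    ∃ (a b : V) (p : G.Walk a b), p.IsPath ∧
      (∀ (a' b' : V) (q : G.Walk a' b'), q.IsPath →
        (∀ z ∈ p.support, ∀ v, Near G z v → ∃ z' ∈ q.support, Near G z' v) →
        (∀ v, (∃ z ∈ q.support, Near G z v) → ∃ z ∈ p.support, Near G z v) ∧
          q.length ≤ p.length) := by
  classical
  let D : (Σ a b, G.Path a b) → Finset V := fun p =>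
    Finset.univ.filter fun v => ∃ z ∈ p.2.2.1.support, Near G z v
  -- A path has length below `Fintype.card V`, so this weight orders lexicographically by number of
  -- dominated vertices, then by length.
  let val : (Σ a b, G.Path a b) → ℕ := fun p =>
    (D p).card * (Fintype.card V + 1) + p.2.2.1.length
  have hlen : ∀ p : (Σ a b, G.Path a b), p.2.2.1.length < Fintype.card V := fun p =>
    p.2.2.2.length_lt
  have hbdd : BddAbove (Set.range val) := by
    refine ⟨Fintype.card V * (Fintype.card V + 1) + Fintype.card V, ?_⟩
    rintro _ ⟨p, rfl⟩
    have h1 : (D p).card ≤ Fintype.card V := Finset.card_le_univ _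
    have h2 := hlen p
    have h3 := Nat.mul_le_mul_right (Fintype.card V + 1) h1
    simp only [val]
    omega
  obtain ⟨v₀⟩ := ‹Nonempty V›
  obtain ⟨p, hp⟩ := Nat.sSup_mem (s := Set.range val)
    ⟨_, ⟨v₀, v₀, SimpleGraph.Path.nil⟩, rfl⟩ hbdd
  have hmax : ∀ q, val q ≤ val p := fun q => hp ▸ le_csSup hbdd ⟨q, rfl⟩
  refine ⟨p.1, p.2.1, p.2.2.1, p.2.2.2, fun a' b' q hq hdom => ?_⟩
  have hm := hmax ⟨a', b', q, hq⟩
  have hsub : D p ⊆ D ⟨a', b', q, hq⟩ := by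
    intro v hv
    simp only [D, Finset.mem_filter, Finset.mem_univ, true_and] at hv ⊢
    obtain ⟨z, hz, hzv⟩ := hv
    exact hdom z hz v hzv
  have hl := hlen p
  have hcard : (D ⟨a', b', q, hq⟩).card ≤ (D p).card := by
    by_contra! hlt
    have h3 := Nat.mul_le_mul_right (Fintype.card V + 1) (Nat.succ_le_of_lt hlt)
    simp only [val, Nat.succ_eq_add_one, Nat.add_mul] at hm h3
    omega
  have heq := Finset.eq_of_subset_of_card_le hsub hcard
  refine ⟨fun v hv => ?_, ?_⟩
  · have h : v ∈ D ⟨a', b', q, hq⟩ := by simpa [D] using hv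
    rw [← heq] at h
    simpa [D] using h
  · simp only [val, ← heq] at hm
    omega

/-- A `k`-connected graph without a dominating path has at least `(k + 2) (k + 1) + k` vertices. -/
theorem IsKConnected.hasDominatingPath_of_card_lt [Fintype V] {k : ℕ} (hG : IsKConnected G k)
    (hn : Fintype.card V < (k + 2) * (k + 1) + k) : HasDominatingPath G := by
  classical
  by_contra hno
  have hne : Nonempty V := Fintype.card_pos_iff.1 (Nat.zero_lt_of_lt hG.1)
  obtain ⟨a, b, p, hp, hmax⟩ := exists_optimal_path G
  obtain ⟨u, hu⟩ : ∃ u, ∀ z ∈ p.support, ¬ Near G z u := by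
    by_contra! hall
    exact hno (hasDominatingPath_of_forall_near hp hall)
  have hmem : ∀ s, p.getVert s ∈ p.support := fun s => p.getVert_mem_support s
  have hsupp : ∀ z, z ∈ p.support → ∃ s ≤ p.length, p.getVert s = z := fun z hz => by
    obtain ⟨s, e, hs⟩ := SimpleGraph.Walk.mem_support_iff_exists_getVert.1 hz
    exact ⟨s, hs, e⟩
  -- With fewer than `k` vertices on the path, its end `b` would have a neighbour off it, and
  -- appending that neighbour would lengthen the path without losing domination.
  have hkL : k ≤ p.length + 1 := by
    by_contra! hlt
    have hdeg := hG.le_card_adj b (N := Finset.univ.filter (G.Adj b)) (by simp)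
    obtain ⟨y, hy, hyp⟩ : ∃ y, G.Adj b y ∧ y ∉ p.support := by
      by_contra! hall
      have hsub : Finset.univ.filter (G.Adj b) ⊆ p.support.toFinset := by
        intro y hy
        simpa using hall y (by simpa using hy)
      have h1 := Finset.card_le_card hsub
      have h2 := p.support.toFinset_card_le
      rw [SimpleGraph.Walk.length_support] at h2
      omega
    have h := (hmax _ _ (p.concat hy) (hp.concat hyp hy) fun z hz v hv =>
      ⟨z, by simp [SimpleGraph.Walk.support_concat, hz], hv⟩).2
    simp at h
  obtain ⟨F⟩ := exists_fanSystem (f := p.getVert) (L := p.length) (u := u) hG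
    (fun s hs => p.adj_getVert_succ hs)
    (fun s hs t ht e => hp.getVert_injOn hs ht e) (fun s _ => hu _ (hmem s)) hkL
  refine absurd (F.card_le ?_ hG) (by omega)
  -- A path through `u` dominating all that `p` does also dominates `u`, which contradicts the
  -- choice of `p`.
  rintro a' b' W ⟨q, hq, hW⟩ huW
  by_contra! hcon
  obtain ⟨z, hz, hzu⟩ := (hmax _ _ q hq fun z hz v hv => by
    obtain ⟨s, hs, rfl⟩ := hsupp z hz
    obtain ⟨z', hz', hzv'⟩ := hcon s hs v hv
    exact ⟨z', (hW z').1 hz', hzv'⟩).1 u ⟨u, (hW u).1 huW, Or.inl rfl⟩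
  exact hu z hz hzu

end PathEcc

theorem mainTheorem10 {V : Type*} [Fintype V] (G : SimpleGraph V) (k : ℕ) (hk : 2 ≤ k)
    (hG : PathEcc.IsKConnected G k)
    (hkn : (k : ℝ) > ((Fintype.card V : ℝ) - 4) / 5) :
    PathEcc.HasDominatingPath G := by
  refine hG.hasDominatingPath_of_card_lt ?_
  have h : (Fintype.card V : ℝ) < 5 * k + 4 := by linarith
  have h' : Fintype.card V < 5 * k + 4 := by exact_mod_cast h
  -- The bound needed is `5 k + 4 ≤ (k + 2) (k + 1) + k`, that is `0 ≤ (k - 2) (k + 1)`.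
  nlinarith
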